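/- Index four binary variables by $1,2,3,4$ and let $\mathcal K=\{(1,2),(1,4),(3,2),(3,4)\}$. Consider collections $\beta=\bigl((\beta_{i,j})_{(i,j)\in\mathcal K},(\beta_i)_{i=1}^4\bigr)$ of functions $\beta_{i,j}:\{0,1\}^2\to\mathbb R_{\ge 0}$ and $\beta_i:\{0,1\}\to\mathbb R_{\ge 0}$. Let $\mathcal M$ be the set of all $\beta$ that are realizable by a joint probability mass function, i.e. for which there is a function $f:\{0,1\}^4\to\mathbb R_{\ge 0}$ with $Z=\sum_{x}f(x)\neq 0$ such that, with $p=f/Z$, the function $\beta_{i,j}$ is the marginal of $p$ on $(x_i,x_j)$ for every $(i,j)\in\mathcal K$ and $\beta_i$ is the marginal of $p$ on $x_i$ for every $i$. For $\beta\in\mathcal M$ with $0<\beta_i(0)<1$ for all $i$, let $\mathrm{Corr}(\beta_{i,j})=\mathrm{Cov}(Y_1,Y_2)/\sqrt{\mathrm{Var}(Y_1)\,\mathrm{Var}(Y_2)}$ be the Pearson correlation coefficient of two $\{0,1\}$-valued random variables $Y_1,Y_2$ with $\Pr(Y_1=a,Y_2=b)=\beta_{i,j}(a,b)$, and put $$\mathrm{CorrCHSH}(\beta)=\mathrm{Corr}(\beta_{1,2})+\mathrm{Corr}(\beta_{1,4})+\mathrm{Corr}(\beta_{3,2})-\mathrm{Corr}(\beta_{3,4}).$$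 Theorem. For every $\beta\in\mathcal M$ with $0<\beta_i(0)<1$ for all $i\in\{1,2,3,4\}$ one has $|\mathrm{CorrCHSH}(\beta)|\le 5/2$. Moreover, there is a $\beta^*\in\mathcal M$ with $0<\beta^*_i(0)<1$ for all $i$ and $\mathrm{CorrCHSH}(\beta^*)=5/2$. -/

import Mathlib

open MeasureTheory ProbabilityTheory
open scoped NNReal

namespace BinaryMarginals

/-- Configurations `x = (x₁, x₂, x₃, x₄)` of four binary variables. The variables `x₁, x₂, x₃, x₄`
are indexed by `0, 1, 2, 3 : Fin 4`. -/
abbrev Config : Type := Fin 4 → Fin 2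

/-- The index set of the pairs `(1,2), (1,4), (3,2), (3,4)`. -/
def K : Finset (Fin 4 × Fin 4) := {(0, 1), (0, 3), (2, 1), (2, 3)}

/-- A collection of candidate marginals: a nonnegative `2 × 2` matrix `β_{i,j}` (rows indexed by
`x_i`, columns by `x_j`) for every pair in `K`, and a nonnegative diagonal `2 × 2` matrix `β_i`,
given by its diagonal entries `β_i(0), β_i(1)`, for every variable. No further condition is
imposed. -/
structure Beliefs where
  pair : K → Matrix (Fin 2) (Fin 2) ℝ≥0
  single : Fin 4 → Fin 2 → ℝ≥0

/-- The partition function of the factor graph which has the single function node `f`, incident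
to four half edges; its global function is `f` itself. -/
def partitionFunction (f : Config → ℝ≥0) : ℝ≥0 := ∑ x, f x

/-- The probability mass function induced by `f` (used only if the partition function is not
zero). -/
noncomputable def inducedPMF (f : Config → ℝ≥0) (x : Config) : ℝ≥0 := f x / partitionFunction f

/-- The marginal of `(x_i, x_j)`. -/
def pairMarginal (p : Config → ℝ≥0) (i j : Fin 4) : Matrix (Fin 2) (Fin 2) ℝ≥0 :=
  Matrix.of fun a b => ∑ x : Config with x i = a ∧ x j = b, p x

/-- The marginal of `x_i`. -/
def singleMarginal (p : Config → ℝ≥0) (i : Fin 4) (a : Fin 2) : ℝ≥0 :=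
  ∑ x : Config with x i = a, p x

/-- The set of realizable marginals of the factor graph with a single function node: the marginals
of the PMFs induced by arbitrary nonnegative local functions, not identically zero. -/
def realizableMarginals : Set Beliefs :=
  {β | ∃ f : Config → ℝ≥0, partitionFunction f ≠ 0 ∧
    (∀ e : K, β.pair e = pairMarginal (inducedPMF f) e.1.1 e.1.2) ∧
    (∀ i : Fin 4, β.single i = singleMarginal (inducedPMF f) i)}

/-- The measure on `{0,1} × {0,1}` that gives the point `(a, b)` the mass `B a b`. -/
noncomputable def pairMeasure (B : Matrix (Fin 2) (Fin 2) ℝ≥0) : Measure (Fin 2 × Fin 2) :=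
  ∑ z : Fin 2 × Fin 2, B z.1 z.2 • Measure.dirac z

/-- The first coordinate, as a real random variable with values in `{0,1}`. -/
def Y₁ (z : Fin 2 × Fin 2) : ℝ := (z.1 : ℕ)

/-- The second coordinate, as a real random variable with values in `{0,1}`. -/
def Y₂ (z : Fin 2 × Fin 2) : ℝ := (z.2 : ℕ)

/-- The Pearson correlation coefficient of two binary random variables with joint PMF `B`. It is
meaningful if both variances are positive. -/
noncomputable def corr (B : Matrix (Fin 2) (Fin 2) ℝ≥0) : ℝ :=
  cov[Y₁, Y₂; pairMeasure B] / √(Var[Y₁; pairMeasure B] * Var[Y₂; pairMeasure B])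

/-- `Corr(β₁₂) + Corr(β₁₄) + Corr(β₃₂) - Corr(β₃₄)`. -/
noncomputable def corrCHSH (β : Beliefs) : ℝ :=
  corr (β.pair ⟨(0, 1), by decide⟩) + corr (β.pair ⟨(0, 3), by decide⟩)
    + corr (β.pair ⟨(2, 1), by decide⟩) - corr (β.pair ⟨(2, 3), by decide⟩)

end BinaryMarginals

/-!
The four variables are the indicators of events `A`, `B`, `A'`, `C` (in the order of their indices),
and the quantity to be bounded is
`corr(A, B) + corr(A, C) + corr(A', B) + corr(A', Cᶜ)`.

For fixed `B`, `C`, the first two terms are the correlation of the indicator of `A` with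
`g = b + c`, up to the factor `sd g`, where `b` and `c` are the standardized indicators of `B` and
`C`. Superlevel sets of `g` maximize this correlation (`sum_le_mul_sd_of_superlevel`), and they are
increasing in `B` and `C`. Hence `A` may be taken to be one of `∅`, `Ω`, `B`, `C`, `B ∩ C`, `B ∪ C`
(`exists_increasing_ge`), and likewise `A'` with `Cᶜ` in place of `C`.

If, for instance, `A = B`, then the first term is `1` and the other three are at most `3 / 2` in
total, because `E (a - b + c) ^ 2 ≥ 0` for standardized `a`, `b`, `c` (`eventCorr_triangle`).
If, for instance, `A = B ∩ C` and `A' = B ∩ Cᶜ`, then `A ⊆ C ⊆ A'ᶜ`. Correlations multiply along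
such a chain, so `corr(A, C) + corr(C, A'ᶜ) ≤ 1 + corr(A, A'ᶜ)` (`eventCorr_chain`), and
`eventCorr_triangle` applies to what remains. Either way the total is at most `1 + 3 / 2`
(`chsh_le_of_increasing`).

Equality holds when `A = B` and `b = a' + c`, which happens if `A'` and `C` are disjoint with union
`B` and `A'`, `C`, `Bᶜ` have probability `1 / 3` each.
-/

namespace BinaryMarginals

/-! ### Events on a finite weighted space -/

section Events

set_option linter.unusedSectionVars false

variable {Ω : Type*} [Fintype Ω] [DecidableEq Ω]

/-- The probability of the event `A` when the point `ω` has the weight `p ω`. -/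
def prob (p : Ω → ℝ) (A : Finset Ω) : ℝ := ∑ ω ∈ A, p ω

/-- The standard deviation of the indicator function of `A`. -/
noncomputable def sd (p : Ω → ℝ) (A : Finset Ω) : ℝ := √(prob p A * (1 - prob p A))

/-- The indicator function of `A`, centred and divided by its standard deviation. It is zero if
the standard deviation is zero. -/
noncomputable def std (p : Ω → ℝ) (A : Finset Ω) (ω : Ω) : ℝ :=
  ((if ω ∈ A then 1 else 0) - prob p A) / sd p A

/-- The correlation coefficient of the indicator functions of two events. It is zero if one of the
events has probability `0` or `1`. -/
noncomputable def eventCorr (p : Ω → ℝ) (A B : Finset Ω) : ℝ := ∑ ω, p ω * (std p A ω * std p B ω)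

lemma prob_compl {p : Ω → ℝ} (h1 : ∑ ω, p ω = 1) (A : Finset Ω) :
    prob p Aᶜ = 1 - prob p A := by
  have := Finset.sum_add_sum_compl A p
  simp only [prob]
  linarith

lemma prob_nonneg {p : Ω → ℝ} (h0 : ∀ ω, 0 ≤ p ω) (A : Finset Ω) : 0 ≤ prob p A :=
  Finset.sum_nonneg fun ω _ => h0 ω

lemma prob_le_one {p : Ω → ℝ} (h0 : ∀ ω, 0 ≤ p ω) (h1 : ∑ ω, p ω = 1) (A : Finset Ω) :
    prob p A ≤ 1 := by
  have := prob_nonneg h0 Aᶜ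
  rw [prob_compl h1] at this
  linarith

lemma sd_nonneg (p : Ω → ℝ) (A : Finset Ω) : 0 ≤ sd p A := Real.sqrt_nonneg _

lemma sd_sq {p : Ω → ℝ} (h0 : ∀ ω, 0 ≤ p ω) (h1 : ∑ ω, p ω = 1) (A : Finset Ω) :
    sd p A ^ 2 = prob p A * (1 - prob p A) :=
  Real.sq_sqrt (mul_nonneg (prob_nonneg h0 A) (by linarith [prob_le_one h0 h1 A]))

lemma sd_compl {p : Ω → ℝ} (h1 : ∑ ω, p ω = 1) (A : Finset Ω) : sd p Aᶜ = sd p A := by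
  rw [sd, sd, prob_compl h1]
  congr 1
  ring

lemma std_compl {p : Ω → ℝ} (h1 : ∑ ω, p ω = 1) (A : Finset Ω) (ω : Ω) :
    std p Aᶜ ω = -std p A ω := by
  rw [std, std, prob_compl h1, sd_compl h1, ← neg_div]
  congr 1
  by_cases h : ω ∈ A <;> simp [h]

lemma eventCorr_comm (p : Ω → ℝ) (A B : Finset Ω) : eventCorr p A B = eventCorr p B A :=
  Finset.sum_congr rfl fun ω _ => by ring

lemma eventCorr_compl_left {p : Ω → ℝ} (h1 : ∑ ω, p ω = 1) (A B : Finset Ω) :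
    eventCorr p Aᶜ B = -eventCorr p A B := by
  simp [eventCorr, std_compl h1]

lemma eventCorr_compl_right {p : Ω → ℝ} (h1 : ∑ ω, p ω = 1) (A B : Finset Ω) :
    eventCorr p A Bᶜ = -eventCorr p A B := by
  simp [eventCorr, std_compl h1]

lemma sum_mul_std (p : Ω → ℝ) (A B : Finset Ω) :
    ∑ ω ∈ A, p ω * std p B ω = (prob p (A ∩ B) - prob p A * prob p B) / sd p B := by
  simp only [std, mul_div_assoc', ← Finset.sum_div, mul_sub, Finset.sum_sub_distrib, prob,
    ← Finset.sum_mul]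
  simp [Finset.sum_ite_mem]

lemma sum_univ_mul_std {p : Ω → ℝ} (h1 : ∑ ω, p ω = 1) (B : Finset Ω) :
    ∑ ω, p ω * std p B ω = 0 := by
  rw [sum_mul_std]
  simp [prob, h1]

lemma eventCorr_eq_sum_div {p : Ω → ℝ} (h1 : ∑ ω, p ω = 1) (A B : Finset Ω) :
    eventCorr p A B = (∑ ω ∈ A, p ω * std p B ω) / sd p A := by
  have h : eventCorr p A B = (∑ ω, (if ω ∈ A then p ω * std p B ω else 0)
      - prob p A * ∑ ω, p ω * std p B ω) / sd p A := by
    rw [eventCorr, Finset.mul_sum, ← Finset.sum_sub_distrib, Finset.sum_div]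
    refine Finset.sum_congr rfl fun ω _ => ?_
    rw [std]
    split_ifs <;> ring
  rw [h, sum_univ_mul_std h1]
  simp [Finset.sum_ite_mem]

lemma eventCorr_eq {p : Ω → ℝ} (h1 : ∑ ω, p ω = 1) (A B : Finset Ω) :
    eventCorr p A B = (prob p (A ∩ B) - prob p A * prob p B) / (sd p A * sd p B) := by
  rw [eventCorr_eq_sum_div h1, sum_mul_std, div_div, mul_comm (sd p B)]

lemma eventCorr_self_le_one {p : Ω → ℝ} (h0 : ∀ ω, 0 ≤ p ω) (h1 : ∑ ω, p ω = 1) (A : Finset Ω) :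
    eventCorr p A A ≤ 1 := by
  rw [eventCorr_eq h1, Finset.inter_self, ← pow_two (sd p A), sd_sq h0 h1]
  exact div_le_one_of_le₀ (by linarith) (by rw [← sd_sq h0 h1]; positivity)

/-- Nonnegativity of the second moment of `a - b + c`, where `a`, `b`, `c` are the standardized
indicator functions, each of second moment at most `1`. -/
lemma eventCorr_triangle {p : Ω → ℝ} (h0 : ∀ ω, 0 ≤ p ω) (h1 : ∑ ω, p ω = 1)
    (A B C : Finset Ω) :
    eventCorr p A B + eventCorr p B C - eventCorr p A C ≤ 3 / 2 := by
  have h : 0 ≤ ∑ ω, p ω * (std p A ω - std p B ω + std p C ω) ^ 2 :=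
    Finset.sum_nonneg fun ω _ => mul_nonneg (h0 ω) (sq_nonneg _)
  have e : ∑ ω, p ω * (std p A ω - std p B ω + std p C ω) ^ 2
      = eventCorr p A A + eventCorr p B B + eventCorr p C C
        - 2 * (eventCorr p A B + eventCorr p B C - eventCorr p A C) := by
    simp only [eventCorr, ← Finset.sum_add_distrib, ← Finset.sum_sub_distrib, Finset.mul_sum]
    exact Finset.sum_congr rfl fun ω _ => by ring
  linarith [eventCorr_self_le_one h0 h1 A, eventCorr_self_le_one h0 h1 B,
    eventCorr_self_le_one h0 h1 C]

lemma eventCorr_le_one {p : Ω → ℝ} (h0 : ∀ ω, 0 ≤ p ω) (h1 : ∑ ω, p ω = 1)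
    (A B : Finset Ω) : eventCorr p A B ≤ 1 := by
  have h : 0 ≤ ∑ ω, p ω * (std p A ω - std p B ω) ^ 2 :=
    Finset.sum_nonneg fun ω _ => mul_nonneg (h0 ω) (sq_nonneg _)
  have e : ∑ ω, p ω * (std p A ω - std p B ω) ^ 2
      = eventCorr p A A + eventCorr p B B - 2 * eventCorr p A B := by
    simp only [eventCorr, ← Finset.sum_add_distrib, ← Finset.sum_sub_distrib, Finset.mul_sum]
    exact Finset.sum_congr rfl fun ω _ => by ring
  linarith [eventCorr_self_le_one h0 h1 A, eventCorr_self_le_one h0 h1 B]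

/-- Correlations multiply along a chain of events, and `(1 - x) * (1 - y) ≥ 0` for `x, y ≤ 1`. -/
lemma eventCorr_chain {p : Ω → ℝ} (h0 : ∀ ω, 0 ≤ p ω) (h1 : ∑ ω, p ω = 1)
    {A B C : Finset Ω} (hAB : A ⊆ B) (hBC : B ⊆ C) (hB : 0 < sd p B) :
    eventCorr p A B + eventCorr p B C ≤ 1 + eventCorr p A C := by
  have hmul : eventCorr p A C = eventCorr p A B * eventCorr p B C := by
    rw [eventCorr_eq h1, eventCorr_eq h1, eventCorr_eq h1, Finset.inter_eq_left.2 hAB,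
      Finset.inter_eq_left.2 hBC, Finset.inter_eq_left.2 (hAB.trans hBC), div_mul_div_comm]
    have e : (prob p A - prob p A * prob p B) * (prob p B - prob p B * prob p C)
        = sd p B ^ 2 * (prob p A - prob p A * prob p C) := by
      rw [sd_sq h0 h1]; ring
    have e' : sd p A * sd p B * (sd p B * sd p C) = sd p B ^ 2 * (sd p A * sd p C) := by ring
    rw [e, e', mul_div_mul_left _ _ (by positivity)]
  nlinarith [eventCorr_le_one h0 h1 A B, eventCorr_le_one h0 h1 B C]

/-! ### Superlevel sets maximize the correlation -/

/-- Every number in `[0, 1]` lies between the probabilities of a strict and a weak superlevel set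
of `g` at some common level. -/
lemma exists_level {p : Ω → ℝ} (h1 : ∑ ω, p ω = 1) (g : Ω → ℝ) {m : ℝ}
    (hm0 : 0 ≤ m) (hm1 : m ≤ 1) :
    ∃ γ, prob p {ω | γ < g ω} ≤ m ∧ m ≤ prob p {ω | γ ≤ g ω} := by
  have hne : (Finset.univ : Finset Ω).Nonempty := by
    by_contra h
    simp [Finset.not_nonempty_iff_eq_empty.1 h] at h1
  obtain ⟨ω₀, -, hmin⟩ := Finset.exists_min_image Finset.univ g hne
  obtain ⟨ω₁, hω₁, hmax⟩ := Finset.exists_max_image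
    ({ω | m ≤ prob p {ω' | g ω ≤ g ω'}} : Finset Ω) g ⟨ω₀, by
      have : ({ω' | g ω₀ ≤ g ω'} : Finset Ω) = Finset.univ := by
        ext ω; simpa using hmin ω (Finset.mem_univ _)
      rw [Finset.mem_filter, this, prob, h1]
      exact ⟨Finset.mem_univ _, hm1⟩⟩
  refine ⟨g ω₁, ?_, by simpa using hω₁⟩
  rcases ({ω | g ω₁ < g ω} : Finset Ω).eq_empty_or_nonempty with he | hn
  · simpa [he, prob] using hm0
  -- the strict superlevel set is the weak one at the next value of `g`
  obtain ⟨ω₂, hω₂, hmin₂⟩ := Finset.exists_min_image _ g hn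
  have hlt : g ω₁ < g ω₂ := by simpa using hω₂
  have heq : ({ω | g ω₁ < g ω} : Finset Ω) = ({ω | g ω₂ ≤ g ω} : Finset Ω) := by
    ext ω
    simp only [Finset.mem_filter, Finset.mem_univ, true_and]
    exact ⟨fun h => hmin₂ ω (by simpa using h), fun h => hlt.trans_le h⟩
  rw [heq]
  by_contra hc
  exact absurd (hmax ω₂ (by simpa using (not_le.1 hc).le)) (not_le.2 hlt)

/-- Among all events, the sum of `p * (g - γ)` is largest on an event between the strict and the
weak superlevel set of `g` at `γ`. -/
lemma sum_mul_sub_le {p : Ω → ℝ} (h0 : ∀ ω, 0 ≤ p ω) (g : Ω → ℝ) (γ : ℝ)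
    (A : Finset Ω) {N : Finset Ω} (hN : ∀ ω ∈ N, γ ≤ g ω) (hN' : ∀ ω ∉ N, g ω ≤ γ) :
    ∑ ω ∈ A, p ω * g ω - γ * prob p A ≤ ∑ ω ∈ N, p ω * g ω - γ * prob p N := by
  have e : ∀ S : Finset Ω, ∑ ω ∈ S, p ω * g ω - γ * prob p S
      = ∑ ω, if ω ∈ S then p ω * (g ω - γ) else 0 := by
    intro S
    rw [Finset.sum_ite_mem, Finset.univ_inter, prob, Finset.mul_sum, ← Finset.sum_sub_distrib]
    exact Finset.sum_congr rfl fun ω _ => by ring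
  rw [e, e]
  refine Finset.sum_le_sum fun ω _ => ?_
  by_cases hω : ω ∈ N
  · have := mul_nonneg (h0 ω) (sub_nonneg.2 (hN ω hω))
    split_ifs <;> simp [this]
  · have := mul_nonneg (h0 ω) (sub_nonneg.2 (hN' ω hω))
    split_ifs <;> linarith

lemma sqrt_mul_one_sub_concave {x y s t : ℝ} (hx : 0 ≤ x) (hx' : x ≤ 1) (hy : 0 ≤ y) (hy' : y ≤ 1)
    (hs : 0 ≤ s) (ht : 0 ≤ t) (hst : s + t = 1) :
    s * √(x * (1 - x)) + t * √(y * (1 - y))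
      ≤ √((s * x + t * y) * (1 - (s * x + t * y))) := by
  have h := Real.strictConcaveOn_sqrt.concaveOn.2
    (Set.mem_Ici.2 (mul_nonneg hx (sub_nonneg.2 hx')))
    (Set.mem_Ici.2 (mul_nonneg hy (sub_nonneg.2 hy'))) hs ht hst
  simp only [smul_eq_mul] at h
  refine h.trans (Real.sqrt_le_sqrt ?_)
  obtain rfl : t = 1 - s := by linarith
  nlinarith [mul_nonneg (mul_nonneg hs ht) (sq_nonneg (x - y))]

/-- A bound `M` on the correlation with `g` need only be verified for superlevel sets of `g`: for
events of a given probability `m`, the covariance with `g` is at most the piecewise linear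
interpolation in `m` of its values at superlevel sets, while the standard deviation is concave
in `m`. -/
lemma sum_le_mul_sd_of_superlevel {p : Ω → ℝ} (h0 : ∀ ω, 0 ≤ p ω) (h1 : ∑ ω, p ω = 1)
    (g : Ω → ℝ) {M : ℝ} (hM : 0 ≤ M)
    (hlt : ∀ γ, ∑ ω with γ < g ω, p ω * g ω ≤ M * sd p {ω | γ < g ω})
    (hle : ∀ γ, ∑ ω with γ ≤ g ω, p ω * g ω ≤ M * sd p {ω | γ ≤ g ω}) (A : Finset Ω) :
    ∑ ω ∈ A, p ω * g ω ≤ M * sd p A := by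
  obtain ⟨γ, hγ, hγ'⟩ := exists_level h1 g (prob_nonneg h0 A) (prob_le_one h0 h1 A)
  have k := sum_mul_sub_le h0 g γ A (N := ({ω | γ < g ω} : Finset Ω))
    (by simpa using fun ω h => le_of_lt h) (by simp)
  have k' := sum_mul_sub_le h0 g γ A (N := ({ω | γ ≤ g ω} : Finset Ω))
    (by simp) (by simpa using fun ω h => le_of_lt h)
  have l := hlt γ
  have l' := hle γ
  have b0 := prob_nonneg h0 ({ω | γ < g ω} : Finset Ω)
  have b1 := prob_le_one h0 h1 ({ω | γ < g ω} : Finset Ω)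
  have b0' := prob_nonneg h0 ({ω | γ ≤ g ω} : Finset Ω)
  have b1' := prob_le_one h0 h1 ({ω | γ ≤ g ω} : Finset Ω)
  unfold sd at *
  generalize prob p ({ω | γ < g ω} : Finset Ω) = x at *
  generalize prob p ({ω | γ ≤ g ω} : Finset Ω) = y at *
  generalize prob p A = m at *
  rcases hγ.eq_or_lt with rfl | hxm
  · linarith
  have hxy : 0 < y - x := by linarith
  have hc := sqrt_mul_one_sub_concave b0 b1 b0' b1' (s := (y - m) / (y - x))
    (t := (m - x) / (y - x)) (div_nonneg (by linarith) hxy.le) (div_nonneg (by linarith) hxy.le)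
    (by field_simp; ring)
  have em : (y - m) / (y - x) * x + (m - x) / (y - x) * y = m := by field_simp; ring
  rw [em, div_mul_eq_mul_div, div_mul_eq_mul_div, ← add_div, div_le_iff₀ hxy] at hc
  have := mul_le_mul_of_nonneg_left hc hM
  refine le_of_mul_le_mul_right ?_ hxy
  nlinarith [mul_le_mul_of_nonneg_left (k.trans (sub_le_sub_right l _)) (by linarith : 0 ≤ y - m),
    mul_le_mul_of_nonneg_left (k'.trans (sub_le_sub_right l' _)) (by linarith : 0 ≤ m - x)]

/-- The events that are increasing in `B` and `C`: those whose occurrence depends only on which of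
`B` and `C` occur, and is preserved when more of them occur. -/
def increasingEvents (B C : Finset Ω) : Finset (Finset Ω) :=
  {∅, Finset.univ, B ∩ C, B ∪ C, B, C}

lemma mem_increasingEvents {B C N : Finset Ω}
    (h : ∀ ω ∈ N, ∀ ω', (ω ∈ B → ω' ∈ B) → (ω ∈ C → ω' ∈ C) → ω' ∈ N) :
    N ∈ increasingEvents B C := by
  simp only [increasingEvents, Finset.mem_insert, Finset.mem_singleton]
  by_cases h00 : ∃ ω ∈ N, ω ∉ B ∧ ω ∉ C
  · grind
  by_cases h10 : ∃ ω ∈ N, ω ∈ B ∧ ω ∉ C <;> by_cases h01 : ∃ ω ∈ N, ω ∉ B ∧ ω ∈ C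
  · right; right; right; left; grind
  · right; right; right; right; left; grind
  · right; right; right; right; right; grind
  · rcases N.eq_empty_or_nonempty with he | ⟨ω, hω⟩
    · exact Or.inl he
    · right; right; left; grind

lemma std_mono {p : Ω → ℝ} (B : Finset Ω) {ω ω' : Ω} (h : ω ∈ B → ω' ∈ B) :
    std p B ω ≤ std p B ω' := by
  unfold std
  refine div_le_div_of_nonneg_right ?_ (sd_nonneg p B)
  by_cases h1 : ω ∈ B <;> by_cases h2 : ω' ∈ B <;> simp_all

lemma sum_mul_eq_zero_of_sd_eq_zero {p : Ω → ℝ} (h1 : ∑ ω, p ω = 1) (h0 : ∀ ω, 0 ≤ p ω)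
    {g : Ω → ℝ} (hg : ∑ ω, p ω * g ω = 0) {A : Finset Ω} (hA : sd p A = 0) :
    ∑ ω ∈ A, p ω * g ω = 0 := by
  have null : ∀ S : Finset Ω, prob p S = 0 → ∑ ω ∈ S, p ω * g ω = 0 := by
    intro S hS
    refine Finset.sum_eq_zero fun ω hω => ?_
    rw [(Finset.sum_eq_zero_iff_of_nonneg fun ω _ => h0 ω).1 hS ω hω, zero_mul]
  have h := sd_sq h0 h1 A
  rw [hA, zero_pow two_ne_zero] at h
  rcases mul_eq_zero.1 h.symm with h | h
  · exact null A h
  · have hc := null Aᶜ (by rw [prob_compl h1, h])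
    have := Finset.sum_add_sum_compl A fun ω => p ω * g ω
    linarith

/-- For given `B` and `C`, the sum of the correlations of an event `A` with `B` and with `C` is
largest for some event `A` increasing in `B` and `C`. -/
lemma exists_increasing_ge {p : Ω → ℝ} (h0 : ∀ ω, 0 ≤ p ω) (h1 : ∑ ω, p ω = 1)
    (B C A : Finset Ω) (hA : 0 < sd p A) :
    ∃ N ∈ increasingEvents B C,
      eventCorr p A B + eventCorr p A C ≤ eventCorr p N B + eventCorr p N C := by
  set g : Ω → ℝ := fun ω => std p B ω + std p C ω with hgdef
  have key : ∀ S, eventCorr p S B + eventCorr p S C = (∑ ω ∈ S, p ω * g ω) / sd p S := by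
    intro S
    rw [eventCorr_eq_sum_div h1, eventCorr_eq_sum_div h1, ← add_div, ← Finset.sum_add_distrib]
    simp only [hgdef, mul_add]
  have hg : ∑ ω, p ω * g ω = 0 := by
    simp only [hgdef, mul_add, Finset.sum_add_distrib, sum_univ_mul_std h1, add_zero]
  have gmono : ∀ ω ω', (ω ∈ B → ω' ∈ B) → (ω ∈ C → ω' ∈ C) → g ω ≤ g ω' :=
    fun ω ω' hB hC => add_le_add (std_mono B hB) (std_mono C hC)
  obtain ⟨N, hN, hmax⟩ := Finset.exists_max_image (increasingEvents B C)
    (fun S => (∑ ω ∈ S, p ω * g ω) / sd p S) ⟨∅, by simp [increasingEvents]⟩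
  refine ⟨N, hN, ?_⟩
  rw [key, key, div_le_iff₀ hA]
  have hbound : ∀ S ∈ increasingEvents B C,
      ∑ ω ∈ S, p ω * g ω ≤ (∑ ω ∈ N, p ω * g ω) / sd p N * sd p S := by
    intro S hS
    rcases (sd_nonneg p S).eq_or_lt with h | h
    · rw [← h, sum_mul_eq_zero_of_sd_eq_zero h1 h0 hg h.symm, mul_zero]
    · exact (div_le_iff₀ h).1 (hmax S hS)
  refine sum_le_mul_sd_of_superlevel h0 h1 g ?_ (fun γ => hbound _ ?_) (fun γ => hbound _ ?_) A
  · simpa using hmax ∅ (by simp [increasingEvents])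
  · refine mem_increasingEvents fun ω hω ω' hB hC => ?_
    simp only [Finset.mem_filter, Finset.mem_univ, true_and] at hω ⊢
    exact hω.trans_le (gmono ω ω' hB hC)
  · refine mem_increasingEvents fun ω hω ω' hB hC => ?_
    simp only [Finset.mem_filter, Finset.mem_univ, true_and] at hω ⊢
    exact hω.trans (gmono ω ω' hB hC)

/-! ### The upper bound for events -/

lemma eventCorr_empty (p : Ω → ℝ) (B : Finset Ω) : eventCorr p ∅ B = 0 := by
  simp [eventCorr, std, prob, sd]

lemma eventCorr_univ {p : Ω → ℝ} (h1 : ∑ ω, p ω = 1) (B : Finset Ω) :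
    eventCorr p Finset.univ B = 0 := by
  rw [← Finset.compl_empty, eventCorr_compl_left h1, eventCorr_empty, neg_zero]

lemma neg_one_le_eventCorr {p : Ω → ℝ} (h0 : ∀ ω, 0 ≤ p ω) (h1 : ∑ ω, p ω = 1)
    (A B : Finset Ω) : -1 ≤ eventCorr p A B := by
  have := eventCorr_le_one h0 h1 A Bᶜ
  rw [eventCorr_compl_right h1] at this
  linarith

/-- The bound for increasing events. If one of them is trivial, two of the correlations vanish. If
one of them is `B` or `C` up to complement, a correlation is at most `1` and `eventCorr_triangle`
bounds the other three. If both are intersections or unions, one of `B` and `C` lies between them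
in a chain of events, up to complements; `eventCorr_chain` at that event leads back to
`eventCorr_triangle`. -/
lemma chsh_le_of_increasing {p : Ω → ℝ} (h0 : ∀ ω, 0 ≤ p ω) (h1 : ∑ ω, p ω = 1)
    {B C N N' : Finset Ω} (hB : 0 < sd p B) (hC : 0 < sd p C)
    (hN : N ∈ increasingEvents B C) (hN' : N' ∈ increasingEvents B Cᶜ) :
    eventCorr p N B + eventCorr p N C + eventCorr p N' B - eventCorr p N' C ≤ 5 / 2 := by
  have u := eventCorr_le_one h0 h1
  have l := neg_one_le_eventCorr h0 h1
  have t := eventCorr_triangle h0 h1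
  have s := eventCorr_comm p
  have cl := eventCorr_compl_left h1
  have cr := eventCorr_compl_right h1
  have hC' : 0 < sd p Cᶜ := by rwa [sd_compl h1]
  simp only [increasingEvents, Finset.mem_insert, Finset.mem_singleton] at hN hN'
  rcases hN' with rfl | rfl | hN' | hN' | rfl | rfl
  · rw [eventCorr_empty, eventCorr_empty]; linarith [u N B, u N C]
  · rw [eventCorr_univ h1, eventCorr_univ h1]; linarith [u N B, u N C]
  · rcases hN with rfl | rfl | rfl | rfl | rfl | rfl
    · rw [eventCorr_empty, eventCorr_empty]; linarith [u N' B, l N' C]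
    · rw [eventCorr_univ h1, eventCorr_univ h1]; linarith [u N' B, l N' C]
    · have c := eventCorr_chain h0 h1 (A := B ∩ C) (B := C) (C := N'ᶜ)
        Finset.inter_subset_right (fun ω h => by simp [hN', h]) hC
      rw [cr, cr] at c
      linarith [t (B ∩ C) B N', s B N', s C N']
    · have c := eventCorr_chain h0 h1 (A := N') (B := B) (C := B ∪ C)
        (by subst hN'; grind) Finset.subset_union_left hB
      have := t (B ∪ C) C N'ᶜ
      rw [cr, cr] at this
      linarith [s B (B ∪ C), s C N', s N' (B ∪ C)]
    · linarith [u N N, t C N N', s C N, s C N', s N N']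
    · linarith [u N N, t N B N', s B N', s N N']
  · rcases hN with rfl | rfl | rfl | rfl | rfl | rfl
    · rw [eventCorr_empty, eventCorr_empty]; linarith [u N' B, l N' C]
    · rw [eventCorr_univ h1, eventCorr_univ h1]; linarith [u N' B, l N' C]
    · have c := eventCorr_chain h0 h1 (A := B ∩ C) (B := B) (C := N')
        Finset.inter_subset_left (by subst hN'; grind) hB
      have := t (B ∩ C) C N'ᶜ
      rw [cr, cr] at this
      linarith [s B N', s C N']
    · have c := eventCorr_chain h0 h1 (A := (B ∪ C)ᶜ) (B := Cᶜ) (C := N')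
        (Finset.compl_subset_compl.2 Finset.subset_union_right)
        (hN' ▸ Finset.subset_union_right) hC'
      rw [cl, cl, cl, cr] at c
      linarith [t (B ∪ C) B N', s B N', s C N']
    · linarith [u N N, t C N N', s C N, s C N', s N N']
    · linarith [u N N, t N B N', s B N', s N N']
  · linarith [u N' N', t N' N C, s N N', s C N]
  · rw [cl, cl]; linarith [u C C, t B N C, s B N, s B C]

/-- The bound for arbitrary events `A` and `A'`. The difference of correlations of `A'` is the sum
of its correlations with `B` and with the complement of `C`. -/
lemma chsh_events_le {p : Ω → ℝ} (h0 : ∀ ω, 0 ≤ p ω) (h1 : ∑ ω, p ω = 1) {A B A' C : Finset Ω}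
    (hA : 0 < sd p A) (hB : 0 < sd p B) (hA' : 0 < sd p A') (hC : 0 < sd p C) :
    eventCorr p A B + eventCorr p A C + eventCorr p A' B - eventCorr p A' C ≤ 5 / 2 := by
  obtain ⟨N, hN, h⟩ := exists_increasing_ge h0 h1 B C A hA
  obtain ⟨N', hN', h'⟩ := exists_increasing_ge h0 h1 B Cᶜ A' hA'
  rw [eventCorr_compl_right h1, eventCorr_compl_right h1] at h'
  linarith [chsh_le_of_increasing h0 h1 hB hC hN hN']

/-- The lower bound follows from the upper one by complementing `A` and `A'`. -/
lemma abs_chsh_events_le {p : Ω → ℝ} (h0 : ∀ ω, 0 ≤ p ω) (h1 : ∑ ω, p ω = 1)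
    {A B A' C : Finset Ω}
    (hA : 0 < sd p A) (hB : 0 < sd p B) (hA' : 0 < sd p A') (hC : 0 < sd p C) :
    |eventCorr p A B + eventCorr p A C + eventCorr p A' B - eventCorr p A' C| ≤ 5 / 2 := by
  have h := chsh_events_le h0 h1 (A := Aᶜ) (A' := A'ᶜ) (by rwa [sd_compl h1]) hB
    (by rwa [sd_compl h1]) hC
  simp only [eventCorr_compl_left h1] at h
  exact abs_le.2 ⟨by linarith, chsh_events_le h0 h1 hA hB hA' hC⟩

end Events

/-! ### Correlations of realizable marginals -/

lemma integral_pairMeasure (B : Matrix (Fin 2) (Fin 2) ℝ≥0) (h : Fin 2 × Fin 2 → ℝ) :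
    ∫ z, h z ∂pairMeasure B = ∑ z : Fin 2 × Fin 2, (B z.1 z.2 : ℝ) * h z := by
  rw [pairMeasure, integral_finsetSum_measure (fun z _ => Integrable.of_finite)]
  refine Finset.sum_congr rfl fun z _ => ?_
  rw [integral_smul_nnreal_measure, integral_dirac]
  rfl

lemma corr_eq {B : Matrix (Fin 2) (Fin 2) ℝ≥0}
    (hB : (B 0 0 + B 0 1 + B 1 0 + B 1 1 : ℝ) = 1) :
    corr B = ((B 1 1 : ℝ) - (B 1 0 + B 1 1) * (B 0 1 + B 1 1)) /
      √(((B 1 0 + B 1 1 : ℝ) * (1 - (B 1 0 + B 1 1)))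
        * ((B 0 1 + B 1 1 : ℝ) * (1 - (B 0 1 + B 1 1)))) := by
  have h00 : (B 0 0 : ℝ) = 1 - B 0 1 - B 1 0 - B 1 1 := by linarith
  rw [corr, ← covariance_self (measurable_of_finite Y₁).aemeasurable,
    ← covariance_self (measurable_of_finite Y₂).aemeasurable]
  simp only [covariance, integral_pairMeasure, Fintype.sum_prod_type, Fin.sum_univ_two, Y₁, Y₂,
    Fin.val_zero, Fin.val_one, Nat.cast_zero, Nat.cast_one, h00]
  congr 1
  · ring
  · congr 1
    ring

/-- The event that the variable `i` takes the value `1`. -/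
def one (i : Fin 4) : Finset Config := {x | x i = 1}

lemma coe_singleMarginal_zero (q : Config → ℝ≥0) (i : Fin 4) :
    (singleMarginal q i 0 : ℝ) = prob (fun x => (q x : ℝ)) (one i)ᶜ := by
  have : ({x | x i = 0} : Finset Config) = (one i)ᶜ := by
    ext x
    simp only [one, Finset.mem_filter, Finset.mem_univ, true_and, Finset.mem_compl]
    omega
  simp [singleMarginal, prob, ← this]

lemma corr_pairMarginal {q : Config → ℝ≥0} (hq : ∑ x, (q x : ℝ) = 1) (i j : Fin 4) :
    corr (pairMarginal q i j) = eventCorr (fun x => (q x : ℝ)) (one i) (one j) := by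
  have c : ∀ a b, (pairMarginal q i j a b : ℝ)
      = ∑ x, if x i = a ∧ x j = b then (q x : ℝ) else 0 := by
    intro a b
    simp only [pairMarginal, Matrix.of_apply, NNReal.coe_sum, Finset.sum_filter]
    exact Finset.sum_congr rfl fun x _ => by split_ifs <;> rfl
  have two : ∀ a : Fin 2, a ≠ 1 → a = 0 := by decide
  have c11 : (pairMarginal q i j 1 1 : ℝ) = prob (fun x => (q x : ℝ)) (one i ∩ one j) := by
    rw [c, prob, one, one, ← Finset.filter_and, Finset.sum_filter]
  have r1 : (pairMarginal q i j 1 0 + pairMarginal q i j 1 1 : ℝ)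
      = prob (fun x => (q x : ℝ)) (one i) := by
    rw [c, c, prob, one, Finset.sum_filter, ← Finset.sum_add_distrib]
    refine Finset.sum_congr rfl fun x _ => ?_
    by_cases h : x j = 1
    · simp [h]
    · simp [two _ h]
  have c1 : (pairMarginal q i j 0 1 + pairMarginal q i j 1 1 : ℝ)
      = prob (fun x => (q x : ℝ)) (one j) := by
    rw [c, c, prob, one, Finset.sum_filter, ← Finset.sum_add_distrib]
    refine Finset.sum_congr rfl fun x _ => ?_
    by_cases h : x i = 1
    · simp [h]
    · simp [two _ h]
  have total : (pairMarginal q i j 0 0 + pairMarginal q i j 0 1 + pairMarginal q i j 1 0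
      + pairMarginal q i j 1 1 : ℝ) = 1 := by
    rw [c, c, c, c, ← hq, ← Finset.sum_add_distrib, ← Finset.sum_add_distrib,
      ← Finset.sum_add_distrib]
    refine Finset.sum_congr rfl fun x _ => ?_
    by_cases h : x i = 1 <;> by_cases h' : x j = 1
    · simp [h, h']
    · simp [h, two _ h']
    · simp [two _ h, h']
    · simp [two _ h, two _ h']
  have h0 : ∀ x, 0 ≤ (fun x => (q x : ℝ)) x := fun x => (q x).2
  rw [corr_eq total, eventCorr_eq hq, r1, c1, c11, Real.sqrt_mul]
  · rfl
  · rw [← sd_sq h0 hq]; positivity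

lemma sum_inducedPMF {f : Config → ℝ≥0} (hf : partitionFunction f ≠ 0) :
    ∑ x, (inducedPMF f x : ℝ) = 1 := by
  rw [← NNReal.coe_sum, ← NNReal.coe_one]
  simp only [inducedPMF, ← Finset.sum_div]
  rw [← partitionFunction, div_self hf]

lemma corrCHSH_eq {β : Beliefs} {q : Config → ℝ≥0} (hq : ∑ x, (q x : ℝ) = 1)
    (hβ : ∀ e : K, β.pair e = pairMarginal q e.1.1 e.1.2) :
    corrCHSH β = eventCorr (fun x => (q x : ℝ)) (one 0) (one 1)
      + eventCorr (fun x => (q x : ℝ)) (one 0) (one 3)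
      + eventCorr (fun x => (q x : ℝ)) (one 2) (one 1)
      - eventCorr (fun x => (q x : ℝ)) (one 2) (one 3) := by
  simp only [corrCHSH, hβ, corr_pairMarginal hq]

lemma abs_corrCHSH_le {β : Beliefs} (hβ : β ∈ realizableMarginals)
    (h : ∀ i : Fin 4, 0 < β.single i 0 ∧ β.single i 0 < 1) : |corrCHSH β| ≤ 5 / 2 := by
  obtain ⟨f, hf, hpair, hsingle⟩ := hβ
  have h1 := sum_inducedPMF hf
  have h0 : ∀ x, 0 ≤ (fun x => (inducedPMF f x : ℝ)) x := fun x => (inducedPMF f x).2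
  have hsd : ∀ i, 0 < sd (fun x => (inducedPMF f x : ℝ)) (one i) := by
    intro i
    have hi := h i
    rw [hsingle, ← NNReal.coe_pos, ← NNReal.coe_lt_coe, coe_singleMarginal_zero,
      NNReal.coe_one] at hi
    rw [← sd_compl h1]
    exact Real.sqrt_pos.2 (mul_pos hi.1 (sub_pos.2 hi.2))
  rw [corrCHSH_eq h1 hpair]
  exact abs_chsh_events_le h0 h1 (hsd 0) (hsd 1) (hsd 2) (hsd 3)

/-! ### A maximizer -/

/-- The support of the maximizing distribution. The third and the fourth variable are indicators
of disjoint events, and the first and the second are both the indicator of their union. -/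
def extremalSupport : Finset Config := {![1, 1, 1, 0], ![1, 1, 0, 1], ![0, 0, 0, 0]}

/-- The local function whose induced distribution is uniform on `extremalSupport`. -/
def extremalFunction (x : Config) : ℝ≥0 := if x ∈ extremalSupport then 1 else 0

lemma partitionFunction_extremalFunction : partitionFunction extremalFunction = 3 := by
  simp only [partitionFunction, extremalFunction, Finset.sum_boole, Finset.filter_univ_mem]
  have : extremalSupport.card = 3 := by decide
  simp [this]

lemma prob_extremal (A : Finset Config) :
    prob (fun x => (inducedPMF extremalFunction x : ℝ)) A = (A ∩ extremalSupport).card / 3 := by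
  simp only [prob, inducedPMF, partitionFunction_extremalFunction, NNReal.coe_div,
    ← Finset.sum_div, extremalFunction]
  congr 1
  rw [← NNReal.coe_sum, Finset.sum_boole, Finset.filter_mem_eq_inter]
  simp

/-- The marginals of the uniform distribution on `extremalSupport`. -/
noncomputable def extremalBeliefs : Beliefs where
  pair e := pairMarginal (inducedPMF extremalFunction) e.1.1 e.1.2
  single i := singleMarginal (inducedPMF extremalFunction) i

lemma extremalBeliefs_mem : extremalBeliefs ∈ realizableMarginals :=
  ⟨extremalFunction, by simp [partitionFunction_extremalFunction], fun _ => rfl, fun _ => rfl⟩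

lemma extremalBeliefs_single (i : Fin 4) :
    0 < extremalBeliefs.single i 0 ∧ extremalBeliefs.single i 0 < 1 := by
  have hc : 0 < ((one i)ᶜ ∩ extremalSupport).card ∧ ((one i)ᶜ ∩ extremalSupport).card < 3 := by
    revert i; decide
  rw [← NNReal.coe_pos, ← NNReal.coe_lt_coe, extremalBeliefs, coe_singleMarginal_zero,
    prob_extremal, NNReal.coe_one, div_lt_one three_pos]
  exact ⟨div_pos (by exact_mod_cast hc.1) three_pos, by exact_mod_cast hc.2⟩

lemma corrCHSH_extremalBeliefs : corrCHSH extremalBeliefs = 5 / 2 := by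
  have h1 := sum_inducedPMF (f := extremalFunction) (by simp [partitionFunction_extremalFunction])
  rw [corrCHSH_eq h1 fun _ => rfl]
  simp only [eventCorr_eq h1, sd, prob_extremal]
  have c0 : (one 0 ∩ extremalSupport).card = 2 := by decide
  have c1 : (one 1 ∩ extremalSupport).card = 2 := by decide
  have c2 : (one 2 ∩ extremalSupport).card = 1 := by decide
  have c3 : (one 3 ∩ extremalSupport).card = 1 := by decide
  have c01 : (one 0 ∩ one 1 ∩ extremalSupport).card = 2 := by decide
  have c03 : (one 0 ∩ one 3 ∩ extremalSupport).card = 1 := by decide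
  have c21 : (one 2 ∩ one 1 ∩ extremalSupport).card = 1 := by decide
  have c23 : (one 2 ∩ one 3 ∩ extremalSupport).card = 0 := by decide
  have v : ((2 : ℕ) / 3 * (1 - (2 : ℕ) / 3) : ℝ) = 2 / 9 := by norm_num
  have v' : ((1 : ℕ) / 3 * (1 - (1 : ℕ) / 3) : ℝ) = 2 / 9 := by norm_num
  rw [c0, c1, c2, c3, c01, c03, c21, c23, v, v', Real.mul_self_sqrt (by norm_num)]
  norm_num

end BinaryMarginals

theorem mainTheorem1 :
    (∀ β ∈ BinaryMarginals.realizableMarginals,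
      (∀ i : Fin 4, 0 < β.single i 0 ∧ β.single i 0 < 1) →
        |BinaryMarginals.corrCHSH β| ≤ 5 / 2) ∧
    (∃ β ∈ BinaryMarginals.realizableMarginals,
      (∀ i : Fin 4, 0 < β.single i 0 ∧ β.single i 0 < 1) ∧
        BinaryMarginals.corrCHSH β = 5 / 2) := by
  exact ⟨fun _ hβ h => BinaryMarginals.abs_corrCHSH_le hβ h,
    BinaryMarginals.extremalBeliefs, BinaryMarginals.extremalBeliefs_mem,
    BinaryMarginals.extremalBeliefs_single, BinaryMarginals.corrCHSH_extremalBeliefs⟩
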